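/- Let $A$ be a unital $C^*$-algebra and let $u,v\in A$ be unitaries with $\|uv-vu\|<2$ such that $uvu^*v^*$ commutes with $u$ and with $v$. Let $A_{u,v}$ be the $C^*$-subalgebra of $A$ generated by $u$ and $v$, and let $T(A_{u,v})$ be the set of its tracial states. For $\theta\in\mathbb{R}$ let $A_\theta$ denote the rotation algebra, i.e. the universal $C^*$-algebra generated by two unitaries $u_\theta,v_\theta$ subject to $u_\theta v_\theta=e^{2\pi i\theta}v_\theta u_\theta$. Let $\log$ denote the continuous branch of the logarithm on $\{e^{it}: -\pi<t<\pi\}$ with $\log e^{it}=it$ (since $\|uvu^*v^*-1\|=\|uv-vu\|<2$, the point $-1$ is not in the spectrum of $uvu^*v^*$, so that $\log(uvu^*v^*)\in A_{u,v}$ is defined by continuous functional calculus). Let $\theta\in(-1/2,1/2)$ and suppose that $T(A_{u,v})\neq\emptyset$ and $$\frac{1}{2\pi i}\,\tau\bigl(\log(uvu^*v^*)\bigr)=\theta\qquad\text{for all }\tau\in T(A_{u,v}).$$ Then $A_{u,v}$ is isomorphic, as a $C^*$-algebra, to a quotient of $A_\theta$ by a closed two-sided ideal, and $uv=e^{2\pi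 i\theta}vu$. In particular, if $\theta$ is irrational, then $A_{u,v}\cong A_\theta$. -/

import Mathlib

open scoped ComplexOrder

noncomputable section

/-! ### The rotation algebra `A_θ`

`A_θ` is the universal C⋆-algebra generated by two unitaries `u_θ`, `v_θ` with
`u_θ v_θ = e^{2πiθ} v_θ u_θ`.  It is built in the usual way: take the free ⋆-algebra on two unitaries
(the group ⋆-algebra of the free group on two generators), form the supremum of all C⋆-seminorms
on it for which the relation holds, and pass to the Hausdorff completion. -/

/-- The free complex ⋆-algebra on two unitaries, i.e. the group algebra of the free group on two
generators.  The parameter `θ` only serves to equip it with a seminorm depending on `θ`. -/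
def PreRotation (_θ : ℝ) : Type := MonoidAlgebra ℂ (FreeGroup (Fin 2))

namespace PreRotation

variable {θ : ℝ}

instance : Ring (PreRotation θ) := inferInstanceAs (Ring (MonoidAlgebra ℂ (FreeGroup (Fin 2))))

instance : Algebra ℂ (PreRotation θ) :=
  inferInstanceAs (Algebra ℂ (MonoidAlgebra ℂ (FreeGroup (Fin 2))))

/-- The element `c • g` of the group algebra. -/
def single (g : FreeGroup (Fin 2)) (c : ℂ) : PreRotation θ := MonoidAlgebra.single g c

lemma single_mul (g h : FreeGroup (Fin 2)) (c d : ℂ) :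
    (single g c * single h d : PreRotation θ) = single (g * h) (c * d) :=
  MonoidAlgebra.single_mul_single ..

lemma one_eq : (1 : PreRotation θ) = single 1 1 := rfl

lemma smul_single (r : ℂ) (g : FreeGroup (Fin 2)) (c : ℂ) :
    (r • single g c : PreRotation θ) = single g (r * c) :=
  MonoidAlgebra.smul_single ..

lemma induction {P : PreRotation θ → Prop} (a : PreRotation θ) (h0 : P 0)
    (hs : ∀ g c, P (single g c)) (hadd : ∀ a b, P a → P b → P (a + b)) : P a := by
  obtain ⟨f⟩ := a
  induction f using Finsupp.induction_linear with
  | zero => exact h0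
  | add f g hf hg => exact hadd _ _ hf hg
  | single g c => exact hs g c

/-- The involution on the group algebra, as an additive map: `(∑ c_g g)⋆ = ∑ conj(c_g) g⁻¹`. -/
def starHomAux :
    MonoidAlgebra ℂ (FreeGroup (Fin 2)) →+ MonoidAlgebra ℂ (FreeGroup (Fin 2)) where
  toFun a := MonoidAlgebra.map (starAddEquiv : ℂ ≃+ ℂ).toAddMonoidHom
    (MonoidAlgebra.mapDomain (fun g : FreeGroup (Fin 2) => g⁻¹) a)
  map_zero' := by rw [MonoidAlgebra.mapDomain_zero, MonoidAlgebra.map_zero]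
  map_add' a b := by rw [MonoidAlgebra.mapDomain_add, MonoidAlgebra.map_add]

/-- The involution on `PreRotation θ`, as an additive map. -/
def starHom : PreRotation θ →+ PreRotation θ := starHomAux

lemma starHom_single (g : FreeGroup (Fin 2)) (c : ℂ) :
    starHom (single g c : PreRotation θ) = single g⁻¹ (star c) := by
  have : starHomAux (MonoidAlgebra.single g c) = MonoidAlgebra.single g⁻¹ (star c) := by
    simp [starHomAux]
  exact this

instance : StarRing (PreRotation θ) where
  star := starHom
  star_involutive a := by
    show starHom (starHom a) = a
    induction a using induction with
    | h0 => simp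
    | hs g c => simp [starHom_single]
    | hadd a b ha hb => rw [map_add, map_add, ha, hb]
  star_mul a b := by
    show starHom (a * b) = starHom b * starHom a
    induction a using induction with
    | h0 => simp
    | hadd a a' ha ha' => rw [add_mul, map_add, map_add, ha, ha', mul_add]
    | hs g c =>
      induction b using induction with
      | h0 => simp
      | hadd b b' hb hb' => rw [mul_add, map_add, map_add, hb, hb', add_mul]
      | hs h d => simp [starHom_single, single_mul, mul_comm]
  star_add := map_add starHom

lemma star_single (g : FreeGroup (Fin 2)) (c : ℂ) :
    star (single g c : PreRotation θ) = single g⁻¹ (star c) := starHom_single g c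

instance : StarModule ℂ (PreRotation θ) where
  star_smul r a := by
    induction a using induction with
    | h0 => simp
    | hs g c => simp [star_single, smul_single]
    | hadd a b ha hb => rw [smul_add, star_add, star_add, ha, hb, smul_add]

/-- The first free unitary. -/
def U : PreRotation θ := single (FreeGroup.of 0) 1

/-- The second free unitary. -/
def V : PreRotation θ := single (FreeGroup.of 1) 1

/-- The C⋆-seminorms on the free ⋆-algebra on two unitaries `U`, `V` for which the relation
`U V = e^{2πiθ} V U` holds. -/
structure IsAdmissible (p : Seminorm ℂ (PreRotation θ)) : Prop where
  mul_le : ∀ a b, p (a * b) ≤ p a * p b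
  star_mul_self : ∀ a, p (star a * a) = p a ^ 2
  relation : p (U * V - Complex.exp (2 * Real.pi * Complex.I * θ) • (V * U)) = 0

variable (θ) in
/-- The type of admissible C⋆-seminorms. -/
abbrev Admissible : Type := {p : Seminorm ℂ (PreRotation θ) // IsAdmissible p}

instance : Nonempty (Admissible θ) :=
  ⟨⟨0, ⟨fun _ _ => by simp, fun _ => by simp, by simp⟩⟩⟩

lemma IsAdmissible.single_le {p : Seminorm ℂ (PreRotation θ)} (hp : IsAdmissible p)
    (g : FreeGroup (Fin 2)) (c : ℂ) : p (single g c) ≤ ‖c‖ := by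
  have h1 : p (single 1 1) = p (single 1 1) ^ 2 := by
    have := hp.star_mul_self (single 1 1)
    simpa [star_single, single_mul] using this
  have h2 : p (single g 1) ^ 2 = p (single 1 1) := by
    have := hp.star_mul_self (single g 1)
    simpa [star_single, single_mul] using this.symm
  have h3 : p (single 1 1) ≤ 1 := by nlinarith [apply_nonneg p (single (θ := θ) 1 1)]
  have h4 : p (single g 1) ≤ 1 := by nlinarith [apply_nonneg p (single (θ := θ) g 1)]
  have h5 : (single g c : PreRotation θ) = c • single g 1 := by simp [smul_single]
  rw [h5, map_smul_eq_mul]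
  exact mul_le_of_le_one_right (norm_nonneg c) h4

lemma bddAbove (a : PreRotation θ) :
    BddAbove (Set.range fun p : Admissible θ => p.1 a) := by
  induction a using induction with
  | h0 => exact ⟨0, by rintro _ ⟨p, rfl⟩; simp⟩
  | hs g c => exact ⟨‖c‖, by rintro _ ⟨p, rfl⟩; exact p.2.single_le g c⟩
  | hadd a b ha hb =>
    obtain ⟨x, hx⟩ := ha
    obtain ⟨y, hy⟩ := hb
    refine ⟨x + y, ?_⟩
    rintro _ ⟨p, rfl⟩
    exact (map_add_le_add p.1 a b).trans (add_le_add (hx ⟨p, rfl⟩) (hy ⟨p, rfl⟩))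

/-- The universal C⋆-seminorm: the supremum of all admissible C⋆-seminorms. -/
def universalNorm (a : PreRotation θ) : ℝ := ⨆ p : Admissible θ, p.1 a

lemma le_universalNorm (p : Admissible θ) (a : PreRotation θ) : p.1 a ≤ universalNorm a :=
  le_ciSup (bddAbove a) p

lemma universalNorm_le {a : PreRotation θ} {r : ℝ} (h : ∀ p : Admissible θ, p.1 a ≤ r) :
    universalNorm a ≤ r := ciSup_le h

lemma universalNorm_nonneg (a : PreRotation θ) : 0 ≤ universalNorm a :=
  Real.iSup_nonneg fun p => apply_nonneg p.1 a

instance : SeminormedRing (PreRotation θ) :=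
  RingSeminorm.toSeminormedRing
    { toFun := universalNorm
      map_zero' := by simp [universalNorm]
      add_le' := fun a b => universalNorm_le fun p => (map_add_le_add p.1 a b).trans
        (add_le_add (le_universalNorm p a) (le_universalNorm p b))
      neg' := fun a => by simp [universalNorm]
      mul_le' := fun a b => universalNorm_le fun p => (p.2.mul_le a b).trans
        (mul_le_mul (le_universalNorm p a) (le_universalNorm p b) (apply_nonneg _ _)
          (universalNorm_nonneg a)) }

lemma norm_def (a : PreRotation θ) : ‖a‖ = universalNorm a := rfl

instance : NormedAlgebra ℂ (PreRotation θ) where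
  norm_smul_le r a := universalNorm_le fun p => by
    rw [map_smul_eq_mul]
    exact mul_le_mul_of_nonneg_left (le_universalNorm p a) (norm_nonneg r)

lemma norm_sq_le (a : PreRotation θ) : ‖a‖ * ‖a‖ ≤ ‖star a * a‖ := by
  have h : ‖a‖ ≤ Real.sqrt ‖star a * a‖ := universalNorm_le fun p =>
    Real.le_sqrt_of_sq_le (by
      rw [← p.2.star_mul_self a]; exact le_universalNorm p _)
  calc ‖a‖ * ‖a‖ ≤ Real.sqrt ‖star a * a‖ * Real.sqrt ‖star a * a‖ :=
        mul_self_le_mul_self (norm_nonneg a) h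
    _ = ‖star a * a‖ := Real.mul_self_sqrt (norm_nonneg _)

lemma norm_le_norm_star (a : PreRotation θ) : ‖a‖ ≤ ‖star a‖ := by
  by_contra! hlt
  have h1 := (norm_sq_le a).trans (norm_mul_le (star a) a)
  nlinarith [norm_nonneg (star a)]

instance : NormedStarGroup (PreRotation θ) where
  norm_star_le a := by simpa using norm_le_norm_star (star a)

end PreRotation

/-- The rotation algebra `A_θ`: the Hausdorff completion of the free ⋆-algebra on two unitaries in
the universal C⋆-seminorm. -/
def RotationAlgebra (θ : ℝ) : Type := UniformSpace.Completion (PreRotation θ)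

namespace RotationAlgebra

open UniformSpace

variable {θ : ℝ}

instance : NormedRing (RotationAlgebra θ) :=
  inferInstanceAs (NormedRing (Completion (PreRotation θ)))

instance : CompleteSpace (RotationAlgebra θ) :=
  inferInstanceAs (CompleteSpace (Completion (PreRotation θ)))

instance : Algebra ℂ (RotationAlgebra θ) :=
  inferInstanceAs (Algebra ℂ (Completion (PreRotation θ)))

/-- The canonical map from the free ⋆-algebra on two unitaries to `A_θ`. -/
def of (a : PreRotation θ) : RotationAlgebra θ := (a : Completion (PreRotation θ))

lemma norm_of (a : PreRotation θ) : ‖of a‖ = ‖a‖ := Completion.norm_coe a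

lemma of_add (a b : PreRotation θ) : of (a + b) = of a + of b := Completion.coe_add a b

lemma of_mul (a b : PreRotation θ) : of (a * b) = of a * of b := Completion.coe_mul a b

lemma of_smul (r : ℂ) (a : PreRotation θ) : of (r • a) = r • of a := Completion.coe_smul r a

lemma continuous_of : Continuous (of : PreRotation θ → RotationAlgebra θ) :=
  Completion.continuous_coe _

lemma denseRange_of : DenseRange (of : PreRotation θ → RotationAlgebra θ) :=
  Completion.denseRange_coe

instance : NormedAlgebra ℂ (RotationAlgebra θ) where
  norm_smul_le r a := norm_smul_le (β := Completion (PreRotation θ)) r a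

instance : Star (RotationAlgebra θ) where
  star := Completion.map (star : PreRotation θ → PreRotation θ)

lemma continuous_star' : Continuous (star : RotationAlgebra θ → RotationAlgebra θ) :=
  Completion.continuous_map

lemma star_of (a : PreRotation θ) : star (of a) = of (star a) :=
  Completion.map_coe (starₗᵢ ℂ : PreRotation θ ≃ₗᵢ⋆[ℂ] PreRotation θ).isometry.uniformContinuous a

lemma induction {P : RotationAlgebra θ → Prop} (a : RotationAlgebra θ)
    (hc : IsClosed {a | P a}) (h : ∀ a, P (of a)) : P a :=
  denseRange_of.induction_on a hc h

instance : StarRing (RotationAlgebra θ) where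
  star_involutive a := by
    induction a using induction with
    | hc => exact isClosed_eq (continuous_star'.comp continuous_star') continuous_id
    | h a => rw [star_of, star_of, star_star]
  star_mul a b := by
    induction a using induction with
    | hc => exact isClosed_eq (continuous_star'.comp (continuous_id.mul continuous_const))
              (continuous_const.mul continuous_star')
    | h a =>
      induction b using induction with
      | hc => exact isClosed_eq (continuous_star'.comp (continuous_const.mul continuous_id))
                (continuous_star'.mul continuous_const)
      | h b => simp only [← of_mul, star_of, star_mul]
  star_add a b := by
    induction a using induction with
    | hc => exact isClosed_eq (continuous_star'.comp (continuous_id.add continuous_const))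
              (continuous_star'.add continuous_const)
    | h a =>
      induction b using induction with
      | hc => exact isClosed_eq (continuous_star'.comp (continuous_const.add continuous_id))
                (continuous_const.add continuous_star')
      | h b => simp only [← of_add, star_of, star_add]

/-- `A_θ` is a unital C⋆-algebra. -/
instance : CStarAlgebra (RotationAlgebra θ) where
  norm_mul_self_le a := by
    induction a using induction with
    | hc => exact isClosed_le (continuous_norm.mul continuous_norm)
              (continuous_norm.comp (continuous_star'.mul continuous_id))
    | h a => rw [star_of, ← of_mul, norm_of, norm_of]; exact PreRotation.norm_sq_le a
  star_smul r a := by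
    induction a using induction with
    | hc => exact isClosed_eq (continuous_star'.comp (continuous_const_smul r))
              ((continuous_const_smul (star r)).comp continuous_star')
    | h a => simp only [← of_smul, star_of, star_smul]

end RotationAlgebra

/-! ### The C⋆-subalgebra generated by two elements, tracial states, quotients -/

/-- The (unital) C⋆-subalgebra of `A` generated by `u` and `v`. -/
def cstarGenerated {A : Type*} [CStarAlgebra A] (u v : A) : StarSubalgebra ℂ A :=
  (StarAlgebra.adjoin ℂ {u, v}).topologicalClosure

namespace cstarGenerated

variable {A : Type*} [CStarAlgebra A] (u v : A)

instance : IsClosed (cstarGenerated u v : Set A) :=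
  StarSubalgebra.isClosed_topologicalClosure _

/-- `u` as an element of the C⋆-subalgebra generated by `u` and `v`. -/
def fst : cstarGenerated u v :=
  ⟨u, StarSubalgebra.le_topologicalClosure _ (StarAlgebra.subset_adjoin ℂ _ (by simp))⟩

/-- `v` as an element of the C⋆-subalgebra generated by `u` and `v`. -/
def snd : cstarGenerated u v :=
  ⟨v, StarSubalgebra.le_topologicalClosure _ (StarAlgebra.subset_adjoin ℂ _ (by simp))⟩

/-- `u v u⋆ v⋆` as an element of the C⋆-subalgebra generated by `u` and `v`. -/
def commutator : cstarGenerated u v :=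
  fst u v * snd u v * star (fst u v) * star (snd u v)

end cstarGenerated

/-- A tracial state on a unital C⋆-algebra: a positive unital tracial linear functional. -/
structure TracialState (B : Type*) [CStarAlgebra B] where
  /-- The underlying linear functional. -/
  toLinearMap : B →ₗ[ℂ] ℂ
  nonneg : ∀ b, 0 ≤ toLinearMap (star b * b)
  map_one : toLinearMap 1 = 1
  trace : ∀ a b, toLinearMap (a * b) = toLinearMap (b * a)

/-- The logarithm of a normal element, by continuous functional calculus with the principal branch
(the values of which on the unit circle without `-1` lie in `i(-π, π)`). -/
def cstarLog {B : Type*} [CStarAlgebra B] (w : B) : B := cfc Complex.log w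

/-- `B` is isomorphic, as a C⋆-algebra, to the quotient of `A` by a closed two-sided ideal `I`: there
is an algebra isomorphism `A ⧸ I ≃ B` that respects the involutions (that of `A ⧸ I` being
`(a + I)⋆ = a⋆ + I`) and is isometric for the quotient norm `‖a + I‖ = inf_{x ∈ I} ‖a - x‖`. -/
def IsIsomorphicToQuotient (B A : Type*) [CStarAlgebra B] [CStarAlgebra A] : Prop :=
  ∃ (I : Ideal A) (_ : I.IsTwoSided) (e : (A ⧸ I) ≃ₐ[ℂ] B),
    IsClosed (I : Set A) ∧
    (∀ a : A, e (Ideal.Quotient.mk I (star a)) = star (e (Ideal.Quotient.mk I a))) ∧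
    ∀ a : A, ‖e (Ideal.Quotient.mk I a)‖ = Metric.infDist a (I : Set A)

end

/-! Let `w` be the commutator of `u` and `v`. It is central in the algebra `B` generated by `u` and
`v`, so conjugation by `uv` equals conjugation by `vu`, and the conjugations by `u` and by `v`
commute. Averaging a state along one and then the other gives a tracial state that agrees with it on
the centre (`exists_tracialState_eq_on_center`). As `log w` is central, a common value `c` of all
traces at `log w` is the value of every state there. A nonzero normal element is not killed by all
states, so `log w = c` and `w = exp c` (`commutator_eq_exp_smul_one`).

With `c = 2πiθ` the universal property gives a ⋆-homomorphism from `A_θ` to `B` with dense range.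
Its range is closed and carries the quotient norm, because images lift without increase of norm
(`StarAlgHom.exists_lift_norm_le`).

For irrational `θ`, a trace on `A_θ` kills every monomial `u^m v^n` with `(m, n) ≠ (0, 0)`, and so
does the mean of a state over the gauge action of the torus. Hence a continuous normalised trace is
the mean of any state, which makes it faithful. Applied to a trace pulled back from `B`, this shows
that the homomorphism is injective. -/

open Filter Topology

/-! ### States as contractive unital functionals. -/

section States

variable {D : Type*} [CStarAlgebra D]

/-- By the C⋆-identity `a + it` has squared norm at most `‖a‖² + t²`. This bounds `(Im φ(a) + t)²`
for every real `t`, which is impossible for large `t` of the right sign unless `Im φ(a) = 0`. -/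
lemma im_apply_eq_zero_of_isSelfAdjoint (φ : D →ₗ[ℂ] ℂ) (hφ : ∀ x, ‖φ x‖ ≤ ‖x‖) (h1 : φ 1 = 1)
    {a : D} (ha : IsSelfAdjoint a) : (φ a).im = 0 := by
  have key : ∀ t : ℝ, ((φ a).im + t) ^ 2 ≤ ‖a‖ ^ 2 + t ^ 2 := by
    intro t
    set b : D := a + ((t : ℂ) * Complex.I) • (1 : D) with hb
    have e1 : φ b = φ a + (t : ℂ) * Complex.I := by simp [hb, h1]
    have e2 : star b * b = a * a + ((t : ℂ) ^ 2) • (1 : D) := by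
      have hsb : star b = a - ((t : ℂ) * Complex.I) • (1 : D) := by
        simp [hb, ha.star_eq, sub_eq_add_neg]
      rw [hsb, hb, sub_mul, mul_add, mul_add]
      simp only [smul_mul_assoc, mul_smul_comm, one_mul, mul_one, smul_smul]
      have : (t : ℂ) * Complex.I * (t * Complex.I) = -(t : ℂ) ^ 2 := by
        linear_combination (t : ℂ) ^ 2 * Complex.I_sq
      rw [this, neg_smul]
      abel
    have e3 : ‖b‖ ^ 2 ≤ ‖a‖ ^ 2 + t ^ 2 := by
      rcases subsingleton_or_nontrivial D with hD | hD
      · have : b = 0 := Subsingleton.elim _ _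
        rw [this]; simp; positivity
      rw [sq, ← CStarRing.norm_star_mul_self, e2]
      refine (norm_add_le _ _).trans (add_le_add ?_ ?_)
      · rw [sq]; exact norm_mul_le _ _
      · rw [norm_smul]; simp
    have e4 : ((φ a).im + t) ^ 2 ≤ ‖φ b‖ ^ 2 := by
      rw [e1, Complex.sq_norm, Complex.normSq_apply]
      simp
      nlinarith [sq_nonneg (φ a).re]
    exact e4.trans ((pow_le_pow_left₀ (norm_nonneg _) (hφ b) 2).trans e3)
  by_contra h
  -- This `t` makes the cross term `2 t Im φ(a)` equal to `‖a‖² + 1`, too large for `key`.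
  have h' := key ((‖a‖ ^ 2 + 1) / (2 * (φ a).im))
  have : 2 * (φ a).im * ((‖a‖ ^ 2 + 1) / (2 * (φ a).im)) = ‖a‖ ^ 2 + 1 := by field_simp
  nlinarith [sq_nonneg (φ a).im]

/-- For `a ≥ 0` the element `‖a‖ - a` has norm at most `‖a‖`, so `φ(a)` lies in the disc of radius
`‖a‖` about `‖a‖`. Being real, it is nonnegative. -/
lemma apply_star_mul_self_nonneg (φ : D →ₗ[ℂ] ℂ) (hφ : ∀ x, ‖φ x‖ ≤ ‖x‖) (h1 : φ 1 = 1)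
    (b : D) : 0 ≤ φ (star b * b) := by
  let := CStarAlgebra.spectralOrder D
  have := CStarAlgebra.spectralOrderedRing D
  set a := star b * b with ha_def
  have ha : 0 ≤ a := star_mul_self_nonneg b
  have hsa : IsSelfAdjoint a := .of_nonneg ha
  have hle : a ≤ algebraMap ℝ D ‖a‖ := hsa.le_algebraMap_norm_self
  have hn : ‖algebraMap ℝ D ‖a‖ - a‖ ≤ ‖a‖ := by
    rcases subsingleton_or_nontrivial D with hD | hD
    · have : algebraMap ℝ D ‖a‖ - a = 0 := Subsingleton.elim _ _
      rw [this]; simp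
    refine (CStarAlgebra.norm_le_norm_of_nonneg_of_le (sub_nonneg.2 hle) (sub_le_self _ ha)).trans ?_
    rw [norm_algebraMap']; simp
  have h2 := (hφ _).trans hn
  have h3 : φ (algebraMap ℝ D ‖a‖ - a) = (‖a‖ : ℂ) - φ a := by
    rw [map_sub, Algebra.algebraMap_eq_smul_one, ← Complex.coe_smul, map_smul, h1]; simp
  rw [h3] at h2
  have h4 := (Complex.abs_re_le_norm _).trans h2
  rw [Complex.sub_re, Complex.ofReal_re, abs_le] at h4
  rw [Complex.le_def]
  exact ⟨by simpa using h4.2, by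
    simpa using (im_apply_eq_zero_of_isSelfAdjoint φ hφ h1 hsa).symm⟩

/-- The spectral radius of a normal element is its norm, so the spectrum has a nonzero point.
Evaluation there is a character of the C⋆-algebra generated by `a`, and Hahn–Banach extends it
without increase of norm. -/
lemma exists_state_apply_ne_zero {a : D} [ha : IsStarNormal a] (h0 : a ≠ 0) :
    ∃ φ : D →ₗ[ℂ] ℂ, (∀ x, ‖φ x‖ ≤ ‖x‖) ∧ φ 1 = 1 ∧ φ a ≠ 0 := by
  have : Nontrivial D := ⟨a, 0, h0⟩
  obtain ⟨z, hz, hz'⟩ : ∃ z ∈ spectrum ℂ a, z ≠ 0 := by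
    by_contra! h
    apply h0
    have : spectralRadius ℂ a = 0 := by
      simp only [spectralRadius, ENNReal.iSup_eq_zero]
      intro k hk
      simp [h k hk]
    rw [IsStarNormal.spectralRadius_eq_nnnorm] at this
    simpa using this
  obtain ⟨χ, hχ⟩ := (StarAlgebra.elemental.bijective_characterSpaceToSpectrum a).2 ⟨z, hz⟩
  have hχa : χ ⟨a, StarAlgebra.elemental.self_mem ℂ a⟩ = z := congrArg Subtype.val hχ
  obtain ⟨g, hg, hgn⟩ := exists_extension_norm_eq
    (StarAlgebra.elemental ℂ a).toSubalgebra.toSubmodule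
    (WeakDual.toStrongDual (χ : WeakDual ℂ (StarAlgebra.elemental ℂ a)))
  have hn : ‖g‖ ≤ 1 := by
    rw [hgn]
    refine ContinuousLinearMap.opNorm_le_bound _ zero_le_one fun x => ?_
    rw [one_mul]
    exact AlgHom.norm_apply_le_self (A := StarAlgebra.elemental ℂ a) χ x
  refine ⟨g, fun x => ?_, ?_, ?_⟩
  · exact (g.le_opNorm x).trans (mul_le_of_le_one_left (norm_nonneg x) hn)
  · exact (hg ⟨1, one_mem (StarAlgebra.elemental ℂ a)⟩).trans (map_one χ)
  · have := hg ⟨a, StarAlgebra.elemental.self_mem ℂ a⟩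
    intro h
    exact hz' (hχa.symm.trans (this.symm.trans h))

end States

/-! ### Invariant means of functionals. -/

section Averaging

variable {E : Type*} [SeminormedAddCommGroup E] [NormedSpace ℂ E]

lemma norm_birkhoffAverage_le (T : E →ₗ[ℂ] E) (hT : ∀ x, ‖T x‖ ≤ ‖x‖) (f : E →ₗ[ℂ] ℂ)
    (hf : ∀ x, ‖f x‖ ≤ ‖x‖) (n : ℕ) (x : E) : ‖birkhoffAverage ℂ T f n x‖ ≤ ‖x‖ := by
  have hk : ∀ k, ‖f (T^[k] x)‖ ≤ ‖x‖ := fun k => (hf _).trans <| by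
    induction k with
    | zero => rfl
    | succ k ih => rw [Function.iterate_succ_apply']; exact (hT _).trans ih
  rw [birkhoffAverage, norm_smul, birkhoffSum, norm_inv, Complex.norm_natCast]
  rcases Nat.eq_zero_or_pos n with rfl | hn
  · simp
  · rw [inv_mul_le_iff₀ (by positivity)]
    refine (norm_sum_le _ _).trans ((Finset.sum_le_sum fun k _ => hk k).trans ?_)
    simp

/-- A contractive functional can be averaged along a contraction `T`. -/
lemma exists_invariant_functional (T : E →ₗ[ℂ] E) (hT : ∀ x, ‖T x‖ ≤ ‖x‖) (f : E →ₗ[ℂ] ℂ)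
    (hf : ∀ x, ‖f x‖ ≤ ‖x‖) :
    ∃ g : E →ₗ[ℂ] ℂ, (∀ x, ‖g x‖ ≤ ‖x‖) ∧ (∀ x, g (T x) = g x) ∧
      (∀ x, T x = x → g x = f x) ∧
      ∀ S : E →ₗ[ℂ] E, (∀ x, S (T x) = T (S x)) → (∀ x, f (S x) = f x) → ∀ x, g (S x) = g x := by
  -- Along a free ultrafilter the bounded averages converge for all `x` at once, and the limit is
  -- linear in `x`.
  set F : Ultrafilter ℕ := hyperfilter ℕ
  have hF : (F : Filter ℕ) ≤ atTop := Nat.hyperfilter_le_atTop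
  have hlim : ∀ x, ∃ z, Tendsto (fun n => birkhoffAverage ℂ T f n x) F (𝓝 z) := by
    intro x
    have hc := isCompact_closedBall (0 : ℂ) ‖x‖
    obtain ⟨z, -, hz⟩ := hc.ultrafilter_le_nhds (F.map fun n => birkhoffAverage ℂ T f n x) (by
      rw [le_principal_iff]
      exact mem_map.2 (univ_mem' fun n => by
        simpa using norm_birkhoffAverage_le T hT f hf n x))
    exact ⟨z, hz⟩
  choose g hg using hlim
  have hit : ∀ k x y, T^[k] (x + y) = T^[k] x + T^[k] y := fun k x y => by
    simp only [← Module.End.coe_pow, map_add]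
  have hit' : ∀ k (c : ℂ) x, T^[k] (c • x) = c • T^[k] x := fun k c x => by
    simp only [← Module.End.coe_pow, map_smul]
  refine ⟨⟨⟨g, fun x y => ?_⟩, fun c x => ?_⟩, fun x => ?_, fun x => ?_, fun x hx => ?_, ?_⟩
  · refine tendsto_nhds_unique (hg _) (((hg x).add (hg y)).congr fun n => ?_)
    simp [birkhoffAverage, birkhoffSum, hit, Finset.sum_add_distrib, mul_add]
  · refine tendsto_nhds_unique (hg _) (((hg x).const_smul c).congr fun n => ?_)
    simp [birkhoffAverage, birkhoffSum, hit', ← Finset.mul_sum, mul_left_comm]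
  · exact le_of_tendsto (hg x).norm (Eventually.of_forall fun n =>
      norm_birkhoffAverage_le T hT f hf n x)
  · have h1 := (hg (T x)).sub (hg x)
    have h2 : Tendsto (fun n => birkhoffAverage ℂ T f n (T x) - birkhoffAverage ℂ T f n x)
        F (𝓝 0) := by
      refine (tendsto_birkhoffAverage_apply_sub_birkhoffAverage ℂ ?_).mono_left hF
      refine (Metric.isBounded_closedBall (x := (0 : ℂ)) (r := ‖x‖)).subset ?_
      rintro _ ⟨k, rfl⟩
      rw [mem_closedBall_zero_iff]
      refine (hf _).trans ?_
      induction k with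
      | zero => rfl
      | succ k ih => rw [Function.iterate_succ_apply']; exact (hT _).trans ih
    exact sub_eq_zero.1 (tendsto_nhds_unique h1 h2)
  · exact tendsto_nhds_unique (hg x)
      ((Function.IsFixedPt.tendsto_birkhoffAverage ℂ hx f).mono_left hF)
  -- Every average is already `S`-invariant. This keeps the invariance under the first conjugation
  -- when averaging along the second.
  · intro S hS hfS x
    refine tendsto_nhds_unique (hg (S x)) ((hg x).congr fun n => ?_)
    have : ∀ k, T^[k] (S x) = S (T^[k] x) := fun k =>
      ((Function.Commute.iterate_right (f := S) (g := T) hS k) x).symm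
    simp [birkhoffAverage, birkhoffSum, this, hfS]

end Averaging

/-! ### From states to traces; the commutator is scalar. -/

section CentralCommutator

variable {D : Type*} [CStarAlgebra D]

lemma commute_star_of_mem_unitary {w x : D} (hw : w ∈ unitary D) (h : Commute w x) :
    Commute (star w) x := by
  have h1 := Unitary.star_mul_self_of_mem hw
  have h2 := Unitary.mul_star_self_of_mem hw
  calc star w * x = star w * (x * (w * star w)) := by rw [h2, mul_one]
    _ = star w * (w * x) * star w := by rw [h.eq]; simp only [mul_assoc]
    _ = x * star w := by rw [← mul_assoc, h1, one_mul]

/-- Conjugation `x ↦ u x u⋆` as a linear map. -/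
noncomputable def conjLinearMap (u : D) : D →ₗ[ℂ] D :=
  LinearMap.mulLeft ℂ u ∘ₗ LinearMap.mulRight ℂ (star u)

lemma conjLinearMap_apply (u x : D) : conjLinearMap u x = u * x * star u := by
  simp [conjLinearMap, mul_assoc]

lemma norm_conjLinearMap_le {u : D} (hu : u ∈ unitary D) (x : D) : ‖conjLinearMap u x‖ ≤ ‖x‖ := by
  rw [conjLinearMap_apply, CStarRing.norm_mul_mem_unitary _ (Unitary.star_mem hu),
    CStarRing.norm_mem_unitary_mul _ hu]

lemma conjLinearMap_eq_self {u x : D} (hu : u ∈ unitary D) (h : Commute x u) :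
    conjLinearMap u x = x := by
  rw [conjLinearMap_apply, ← h.eq, mul_assoc, Unitary.mul_star_self_of_mem hu, mul_one]

variable {u v : D}

lemma mul_mul_star_mul_star_mem_unitary (hu : u ∈ unitary D) (hv : v ∈ unitary D) :
    u * v * star u * star v ∈ unitary D :=
  mul_mem (mul_mem (mul_mem hu hv) (Unitary.star_mem hu)) (Unitary.star_mem hv)

lemma mul_eq_commutator_mul (hu : u ∈ unitary D) (hv : v ∈ unitary D) :
    u * v = u * v * star u * star v * (v * u) := by
  rw [mul_assoc _ (star v), ← mul_assoc (star v), Unitary.star_mul_self_of_mem hv, one_mul,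
    mul_assoc, Unitary.star_mul_self_of_mem hu, mul_one]

lemma commute_of_topologicalClosure_adjoin_eq_top
    (hgen : (StarAlgebra.adjoin ℂ {u, v}).topologicalClosure = ⊤) {w : D} (hw : w ∈ unitary D)
    (hwu : Commute w u) (hwv : Commute w v) (x : D) : Commute w x := by
  have hx : x ∈ (StarAlgebra.adjoin ℂ {u, v}).topologicalClosure := hgen ▸ trivial
  refine closure_minimal (t := {x | Commute w x}) (fun y hy => ?_)
    (isClosed_eq (by fun_prop) (by fun_prop)) hx
  -- The stronger claim survives the `star` case, which exchanges its two halves.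
  suffices h : Commute w y ∧ Commute (star w) y from h.1
  induction hy using StarAlgebra.adjoin_induction with
  | mem y hy =>
    obtain rfl | rfl := hy
    · exact ⟨hwu, commute_star_of_mem_unitary hw hwu⟩
    · exact ⟨hwv, commute_star_of_mem_unitary hw hwv⟩
  | algebraMap r => exact ⟨(Algebra.commutes r w).symm, (Algebra.commutes r _).symm⟩
  | add x y _ _ hx hy => exact ⟨hx.1.add_right hy.1, hx.2.add_right hy.2⟩
  | mul x y _ _ hx hy => exact ⟨hx.1.mul_right hy.1, hx.2.mul_right hy.2⟩
  | star x _ hx => exact ⟨by simpa using hx.2.star_star, hx.1.star_star⟩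

/-- Invariance under conjugation by a unitary says that it can be cycled inside `f`. The elements
that can be cycled past every `y` form a closed subalgebra, and the adjoints are carried along in
the induction. -/
lemma map_mul_comm_of_invariant
    (hgen : (StarAlgebra.adjoin ℂ {u, v}).topologicalClosure = ⊤)
    (hu : u ∈ unitary D) (hv : v ∈ unitary D) (f : D →ₗ[ℂ] ℂ) (hf : ∀ x, ‖f x‖ ≤ ‖x‖)
    (hfu : ∀ x, f (conjLinearMap u x) = f x) (hfv : ∀ x, f (conjLinearMap v x) = f x)
    (x y : D) : f (x * y) = f (y * x) := by
  have hfc : Continuous f := (f.mkContinuous 1 (by simpa using hf)).continuous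
  have hgenr : ∀ {z : D}, z ∈ unitary D → (∀ x, f (conjLinearMap z x) = f x) →
      ∀ y, f (z * y) = f (y * z) ∧ f (star z * y) = f (y * star z) := by
    intro z hz h y
    constructor
    · rw [← h (y * z), conjLinearMap_apply, ← mul_assoc, mul_assoc (z * y),
        Unitary.mul_star_self_of_mem hz, mul_one]
    · rw [← h (star z * y), conjLinearMap_apply, ← mul_assoc, Unitary.mul_star_self_of_mem hz,
        one_mul]
  have hx : x ∈ (StarAlgebra.adjoin ℂ {u, v}).topologicalClosure := hgen ▸ trivial
  refine closure_minimal (t := {x | f (x * y) = f (y * x)}) (fun x hx => ?_)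
    (isClosed_eq (by fun_prop) (by fun_prop)) hx
  suffices h : ∀ y, f (x * y) = f (y * x) ∧ f (star x * y) = f (y * star x) from (h y).1
  induction hx using StarAlgebra.adjoin_induction with
  | mem x hx =>
    obtain rfl | rfl := hx
    · exact hgenr hu hfu
    · exact hgenr hv hfv
  | algebraMap r =>
    intro y
    rw [Algebra.commutes, ← algebraMap_star_comm, Algebra.commutes (star r)]
    exact ⟨rfl, rfl⟩
  | add a b _ _ ha hb =>
    intro y
    simp only [star_add, add_mul, mul_add, map_add, (ha y).1, (hb y).1, (ha y).2, (hb y).2,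
      and_self]
  | mul a b _ _ ha hb =>
    intro y
    constructor
    · rw [mul_assoc, (ha _).1, mul_assoc, (hb _).1, mul_assoc]
    · rw [star_mul, mul_assoc, (hb _).2, mul_assoc, (ha _).2, mul_assoc]
  | star a _ ha => exact fun y => ⟨(ha y).2, by simpa using (ha y).1⟩

/-- If the commutator of two unitary generators is central, then every state can be averaged to a
tracial state that agrees with it on the centre. -/
lemma exists_tracialState_eq_on_center
    (hgen : (StarAlgebra.adjoin ℂ {u, v}).topologicalClosure = ⊤)
    (hu : u ∈ unitary D) (hv : v ∈ unitary D)
    (hcu : Commute (u * v * star u * star v) u) (hcv : Commute (u * v * star u * star v) v)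
    (φ : D →ₗ[ℂ] ℂ) (hφ : ∀ x, ‖φ x‖ ≤ ‖x‖) (h1 : φ 1 = 1) :
    ∃ τ : TracialState D, (∀ x, ‖τ.toLinearMap x‖ ≤ ‖x‖) ∧
      ∀ x, Commute x u → Commute x v → τ.toLinearMap x = φ x := by
  have hw := mul_mul_star_mul_star_mem_unitary hu hv
  have hcomm : ∀ x, conjLinearMap u (conjLinearMap v x) = conjLinearMap v (conjLinearMap u x) := by
    intro x
    have hc := commute_of_topologicalClosure_adjoin_eq_top hgen hw hcu hcv
    have e := mul_eq_commutator_mul hu hv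
    set w := u * v * star u * star v
    have e1 : conjLinearMap u (conjLinearMap v x) = u * v * x * star (u * v) := by
      simp [conjLinearMap_apply, mul_assoc]
    have e2 : conjLinearMap v (conjLinearMap u x) = v * u * x * star (v * u) := by
      simp [conjLinearMap_apply, mul_assoc]
    rw [e1, e2, e, star_mul, (hc _).eq, mul_assoc _ w, (hc x).eq,
      mul_assoc, mul_assoc x, ← mul_assoc w, (hc _).eq, mul_assoc _ w,
      Unitary.mul_star_self_of_mem hw, mul_one]
    simp only [mul_assoc]
  obtain ⟨f, hf, hfu, hff, -⟩ := exists_invariant_functional (conjLinearMap u)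
    (norm_conjLinearMap_le hu) φ hφ
  obtain ⟨g, hg, hgv, hgg, hgS⟩ := exists_invariant_functional (conjLinearMap v)
    (norm_conjLinearMap_le hv) f hf
  have hgu := hgS (conjLinearMap u) hcomm hfu
  have hval : ∀ x, Commute x u → Commute x v → g x = φ x := fun x hxu hxv => by
    rw [hgg x (conjLinearMap_eq_self hv hxv), hff x (conjLinearMap_eq_self hu hxu)]
  have hg1 : g 1 = 1 := by rw [hval 1 (Commute.one_left _) (Commute.one_left _), h1]
  exact ⟨⟨g, apply_star_mul_self_nonneg g hg hg1, hg1,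
    map_mul_comm_of_invariant hgen hu hv g hg hgu hgv⟩, hg, hval⟩

/-- Multiplying `w - 1` by the unitary `vu` gives `uv - vu`, so `‖w - 1‖ < 2` and `-1` is not in the
spectrum. It is the only point of the unit circle off the slit plane. -/
lemma commutator_spectrum_subset_slitPlane (hu : u ∈ unitary D) (hv : v ∈ unitary D)
    (hδ : ‖u * v - v * u‖ < 2) :
    spectrum ℂ (u * v * star u * star v) ⊆ Complex.slitPlane := by
  intro z hz
  have : Nontrivial D := by
    by_contra h
    rw [not_nontrivial_iff_subsingleton] at h
    simp [spectrum.of_subsingleton] at hz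
  have hw := mul_mul_star_mul_star_mem_unitary hu hv
  have h1 : ‖z‖ = 1 := by simpa using spectrum.subset_circle_of_unitary hw hz
  have h2 : ‖u * v * star u * star v - 1‖ < 2 := by
    refine lt_of_eq_of_lt ?_ hδ
    have : (u * v * star u * star v - 1) * (v * u) = u * v - v * u := by
      rw [sub_mul, ← mul_eq_commutator_mul hu hv, one_mul]
    rw [← this, CStarRing.norm_mul_mem_unitary _ (mul_mem hv hu)]
  have h3 : ‖z - 1‖ < 2 := by
    refine lt_of_le_of_lt (spectrum.norm_le_norm_of_mem (a := u * v * star u * star v - 1) ?_) h2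
    rw [← map_one (algebraMap ℂ D), ← spectrum.sub_singleton_eq]
    exact Set.sub_mem_sub hz rfl
  rw [Complex.mem_slitPlane_iff_not_le_zero]
  intro hle
  rw [Complex.le_def] at hle
  have hz' : z = ((z.re : ℝ) : ℂ) := Complex.ext rfl (by simpa using hle.2)
  have hre : z.re ≤ 0 := hle.1
  rw [hz', Complex.norm_real, Real.norm_eq_abs, abs_of_nonpos hre] at h1
  have : z = -1 := by rw [hz', show z.re = -1 by linarith]; simp
  rw [this] at h3
  norm_num at h3

/-- If all tracial states take the same value at the logarithm of the commutator, then the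
commutator is a scalar. -/
lemma commutator_eq_exp_smul_one
    (hgen : (StarAlgebra.adjoin ℂ {u, v}).topologicalClosure = ⊤)
    (hu : u ∈ unitary D) (hv : v ∈ unitary D)
    (hδ : ‖u * v - v * u‖ < 2)
    (hcu : Commute (u * v * star u * star v) u) (hcv : Commute (u * v * star u * star v) v)
    (c : ℂ) (hτ : ∀ τ : TracialState D, τ.toLinearMap (cstarLog (u * v * star u * star v)) = c) :
    u * v * star u * star v = Complex.exp c • (1 : D) := by
  have hw := mul_mul_star_mul_star_mem_unitary hu hv
  have hs := commutator_spectrum_subset_slitPlane hu hv hδ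
  set w := u * v * star u * star v with hw_def
  have hn : IsStarNormal w := ⟨by
    rw [commute_iff_eq, Unitary.star_mul_self_of_mem hw, Unitary.mul_star_self_of_mem hw]⟩
  have hlog : ContinuousOn Complex.log (spectrum ℂ w) := fun z hz =>
    (continuousAt_clog (hs hz)).continuousWithinAt
  have hL : cstarLog w = algebraMap ℂ D c := by
    by_contra hne
    have e : cfc (fun z => Complex.log z - c) w = cstarLog w - algebraMap ℂ D c := by
      rw [cfc_sub .., cfc_const .., cstarLog]
    have hnorm : IsStarNormal (cstarLog w - algebraMap ℂ D c) := by
      rw [← e]; exact cfc_predicate _ w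
    -- A state that sees `log w - c` becomes a trace with the same value at `log w`, since `log w`
    -- commutes with `u` and `v`.
    obtain ⟨φ, hφ, h1, h2⟩ := exists_state_apply_ne_zero (sub_ne_zero.2 hne)
    obtain ⟨τ, -, hτφ⟩ := exists_tracialState_eq_on_center hgen hu hv hcu hcv φ hφ h1
    have hcomm : ∀ {x}, Commute w x → Commute (cstarLog w) x := fun h =>
      h.cfc (commute_star_of_mem_unitary hw h) _
    apply h2
    rw [map_sub, ← hτφ _ (hcomm hcu) (hcomm hcv), hτ, Algebra.algebraMap_eq_smul_one, map_smul, h1]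
    simp
  calc w = cfc (fun z => Complex.exp (Complex.log z)) w := by
        conv_lhs => rw [← cfc_id' ℂ w]
        exact cfc_congr fun z hz => (Complex.exp_log (Complex.slitPlane_ne_zero (hs hz))).symm
    _ = cfc Complex.exp (cstarLog w) :=
        cfc_comp' Complex.exp Complex.log w Complex.continuous_exp.continuousOn hlog
    _ = Complex.exp c • (1 : D) := by
        rw [hL, cfc_algebraMap, Algebra.algebraMap_eq_smul_one]

end CentralCommutator

/-- The inclusion into `A` is a closed embedding, so closures may be computed in `A`. -/
lemma cstarGenerated.topologicalClosure_adjoin {A : Type*} [CStarAlgebra A] (u v : A) :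
    (StarAlgebra.adjoin ℂ {fst u v, snd u v}).topologicalClosure = ⊤ := by
  rw [eq_top_iff]
  rintro x -
  have hcl : IsClosed (cstarGenerated u v : Set A) := inferInstance
  have h := StarSubalgebra.topologicalClosure_map (StarAlgebra.adjoin ℂ {fst u v, snd u v})
    (cstarGenerated u v).subtype hcl.isClosedEmbedding_subtypeVal.isClosedMap
    continuous_subtype_val
  rw [StarAlgHom.map_adjoin] at h
  have himg : (cstarGenerated u v).subtype '' {fst u v, snd u v} = {u, v} := by
    rw [Set.image_pair]; rfl
  rw [himg] at h
  have hx : (x : A) ∈ (StarAlgebra.adjoin ℂ {u, v}).topologicalClosure := x.2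
  rw [h] at hx
  obtain ⟨y, hy, hyx⟩ := hx
  have : y = x := Subtype.ext hyx
  exact this ▸ hy

/-! ### The universal property of the rotation algebra. -/

section UniversalProperty

variable {D : Type*} [CStarAlgebra D] {θ : ℝ}

/-- The homomorphism from the free group on two generators determined by two unitaries. -/
noncomputable def wordHom (u v : unitary D) : FreeGroup (Fin 2) →* unitary D :=
  FreeGroup.lift ![u, v]

@[simp] lemma wordHom_of_zero (u v : unitary D) : wordHom u v (FreeGroup.of 0) = u := by
  simp [wordHom]

@[simp] lemma wordHom_of_one (u v : unitary D) : wordHom u v (FreeGroup.of 1) = v := by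
  simp [wordHom]

namespace PreRotation

/-- The representation of the free ⋆-algebra on two unitaries determined by `u` and `v`. -/
noncomputable def lift (u v : unitary D) : PreRotation θ →ₐ[ℂ] D :=
  MonoidAlgebra.lift ℂ D (FreeGroup (Fin 2)) ((unitary D).subtype.comp (wordHom u v))

lemma lift_single (u v : unitary D) (g : FreeGroup (Fin 2)) (c : ℂ) :
    lift u v (single g c : PreRotation θ) = c • (wordHom u v g : D) :=
  MonoidAlgebra.lift_single ..

lemma lift_star (u v : unitary D) (a : PreRotation θ) :
    lift u v (star a) = star (lift u v a) := by
  induction a using induction with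
  | h0 => simp
  | hs g c => rw [star_single, lift_single, lift_single, map_inv, star_smul]; rfl
  | hadd a b ha hb => rw [star_add, map_add, map_add, ha, hb, star_add]

lemma lift_U (u v : unitary D) : lift u v (U : PreRotation θ) = u := by
  rw [U, lift_single, wordHom_of_zero, one_smul]

lemma lift_V (u v : unitary D) : lift u v (V : PreRotation θ) = v := by
  rw [V, lift_single, wordHom_of_one, one_smul]

/-- The norm pulled back along `lift u v` is itself an admissible seminorm, hence below the
supremum. -/
lemma norm_lift_le {u v : unitary D}
    (h : (u * v : D) = Complex.exp (2 * Real.pi * Complex.I * θ) • (v * u : D))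
    (a : PreRotation θ) : ‖lift u v a‖ ≤ ‖a‖ :=
  le_universalNorm ⟨(normSeminorm ℂ D).comp (lift u v).toLinearMap,
    { mul_le := fun a b => by
        simpa using norm_mul_le (lift u v a) (lift u v b)
      star_mul_self := fun a => by
        simp [lift_star, CStarRing.norm_star_mul_self, sq]
      relation := by
        simp [lift_U, lift_V, h] }⟩ a

end PreRotation

namespace RotationAlgebra

lemma of_one : of (1 : PreRotation θ) = 1 := UniformSpace.Completion.coe_one _

/-- The universal property of the rotation algebra. -/
noncomputable def lift (u v : unitary D)
    (h : (u * v : D) = Complex.exp (2 * Real.pi * Complex.I * θ) • (v * u : D)) :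
    RotationAlgebra θ →⋆ₐ[ℂ] D :=
  have huc : UniformContinuous (PreRotation.lift (θ := θ) u v) :=
    (LinearMap.mkContinuous (PreRotation.lift (θ := θ) u v).toLinearMap 1
      (by simpa using PreRotation.norm_lift_le h)).uniformContinuous
  let f : RotationAlgebra θ → D := UniformSpace.Completion.extension (PreRotation.lift (θ := θ) u v)
  have hf : ∀ a, f (of a) = PreRotation.lift u v a := UniformSpace.Completion.extension_coe huc
  have hfc : Continuous f := UniformSpace.Completion.continuous_extension
  have hstar : Continuous (star : RotationAlgebra θ → RotationAlgebra θ) := continuous_star'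
  { toFun := f
    map_one' := by rw [← of_one, hf, map_one]
    map_zero' := by
      have : (0 : RotationAlgebra θ) = of 0 := UniformSpace.Completion.coe_zero.symm
      rw [this, hf, map_zero]
    map_mul' := fun a b => by
      induction a using induction with
      | hc => exact isClosed_eq (by fun_prop) (by fun_prop)
      | h a =>
        induction b using induction with
        | hc => exact isClosed_eq (by fun_prop) (by fun_prop)
        | h b => rw [← of_mul, hf, hf, hf, map_mul]
    map_add' := fun a b => by
      induction a using induction with
      | hc => exact isClosed_eq (by fun_prop) (by fun_prop)
      | h a =>
        induction b using induction with
        | hc => exact isClosed_eq (by fun_prop) (by fun_prop)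
        | h b => rw [← of_add, hf, hf, hf, map_add]
    commutes' := fun r => by
      rw [Algebra.algebraMap_eq_smul_one, ← of_one, ← of_smul, hf, map_smul, map_one,
        Algebra.algebraMap_eq_smul_one]
    map_star' := fun a => by
      induction a using induction with
      | hc => exact isClosed_eq (by fun_prop) (by fun_prop)
      | h a => rw [star_of, hf, hf, PreRotation.lift_star] }

lemma lift_of (u v : unitary D)
    (h : (u * v : D) = Complex.exp (2 * Real.pi * Complex.I * θ) • (v * u : D))
    (a : PreRotation θ) : lift u v h (of a) = PreRotation.lift u v a :=
  UniformSpace.Completion.extension_coe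
    (LinearMap.mkContinuous (PreRotation.lift (θ := θ) u v).toLinearMap 1
      (by simpa using PreRotation.norm_lift_le h)).uniformContinuous a

end RotationAlgebra

end UniversalProperty

/-! ### Ranges of ⋆-homomorphisms and quotient norms. -/

section QuotientNorm

variable {A B : Type*} [CStarAlgebra A] [CStarAlgebra B]

lemma StarAlgHom.continuous_of_cstar (Φ : A →⋆ₐ[ℂ] B) : Continuous Φ :=
  (LinearMap.mkContinuous Φ.toAlgHom.toLinearMap 1
    (by simpa using NonUnitalStarAlgHom.norm_apply_le Φ)).continuous

/-- Elements of the range of a ⋆-homomorphism lift without increasing the norm. -/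
lemma StarAlgHom.exists_lift_norm_le (Φ : A →⋆ₐ[ℂ] B) (a : A) :
    ∃ a', Φ a' = Φ a ∧ ‖a'‖ ≤ ‖Φ a‖ := by
  set c := ‖Φ a‖ with hc_def
  rcases (norm_nonneg (Φ a)).eq_or_lt' with hc | hc
  · exact ⟨0, by rw [map_zero]; exact (norm_eq_zero.1 hc).symm, by simp [hc_def]⟩
  rw [← hc_def] at hc
  -- The lift is `a f(a⋆a)`, which truncates `|a|` at height `c`. On the spectrum of `Φ(a)⋆Φ(a)`,
  -- where `√t ≤ c`, the function `f` is `1`, so the image is unchanged.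
  let f : ℝ → ℝ := fun t => c / max c (Real.sqrt t)
  have hpos : ∀ t, 0 < max c (Real.sqrt t) := fun t => lt_max_of_lt_left hc
  have hf : Continuous f := by
    refine continuous_const.div (by fun_prop) fun t => (hpos t).ne'
  have hsa : IsSelfAdjoint (star a * a) := .star_mul_self a
  have hfa : IsSelfAdjoint (cfc f (star a * a)) := cfc_predicate f _
  have h1 : Φ (cfc f (star a * a)) = 1 := by
    rw [StarAlgHom.map_cfc Φ f (star a * a) hf.continuousOn Φ.continuous_of_cstar hsa
      (hsa.map Φ), map_mul, map_star, ← cfc_one ℝ (star (Φ a) * Φ a)]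
    refine cfc_congr fun t ht => ?_
    have h2 : t ≤ c ^ 2 := by
      have : Nontrivial B := ⟨Φ a, 0, norm_pos_iff.1 hc⟩
      have := (le_abs_self t).trans (spectrum.norm_le_norm_of_mem ht)
      rwa [CStarRing.norm_star_mul_self, ← sq] at this
    have : Real.sqrt t ≤ c := Real.sqrt_le_iff.2 ⟨hc.le, h2⟩
    simp [f, max_eq_left this, hc.ne']
  refine ⟨a * cfc f (star a * a), by rw [map_mul, h1, mul_one], ?_⟩
  refine abs_le_of_sq_le_sq' ?_ hc.le |>.2
  rw [sq, ← CStarRing.norm_star_mul_self]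
  have h3 : star (a * cfc f (star a * a)) * (a * cfc f (star a * a)) =
      cfc (fun t => f t * t * f t) (star a * a) := by
    rw [cfc_mul (fun t => f t * t) f _ (by fun_prop) (by fun_prop),
      cfc_mul f (fun t => t) _ (by fun_prop) (by fun_prop), cfc_id' ℝ (star a * a), star_mul,
      hfa.star_eq]
    simp only [mul_assoc]
  rw [h3]
  refine norm_cfc_le (by positivity) fun t ht => ?_
  have ht0 : 0 ≤ t := spectrum_star_mul_self_nonneg t ht
  rw [Real.norm_eq_abs, abs_of_nonneg (by have := hpos t; positivity)]
  have h4 : Real.sqrt t / max c (Real.sqrt t) ≤ 1 := (div_le_one (hpos t)).2 (le_max_right _ _)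
  have h5 : f t * t * f t = c ^ 2 * (Real.sqrt t / max c (Real.sqrt t)) ^ 2 := by
    simp only [f]
    conv_lhs => rw [← Real.sq_sqrt ht0]
    rw [Real.sqrt_sq (Real.sqrt_nonneg t)]
    ring
  rw [h5]
  exact mul_le_of_le_one_right (by positivity)
    (pow_le_one₀ (div_nonneg (Real.sqrt_nonneg t) (hpos t).le) h4)

/-- Norm-controlled lifts and completeness of `A` let preimages be summed along approximating
series, so the range contains its closure. -/
lemma StarAlgHom.surjective_of_denseRange (Φ : A →⋆ₐ[ℂ] B) (h : DenseRange Φ) :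
    Function.Surjective Φ := by
  let f : NormedAddGroupHom A B :=
    { toFun := Φ
      map_add' := map_add Φ
      bound' := ⟨1, fun a => by simpa using NonUnitalStarAlgHom.norm_apply_le Φ a⟩ }
  have hyp : f.SurjectiveOnWith f.range 1 := by
    rintro _ ⟨a, rfl⟩
    obtain ⟨a', h1, h2⟩ := Φ.exists_lift_norm_le a
    exact ⟨a', h1, by rw [one_mul]; exact h2⟩
  intro b
  obtain ⟨a, ha, -⟩ := controlled_closure_of_complete one_pos one_pos hyp b (h b)
  exact ⟨a, ha⟩

lemma isIsomorphicToQuotient_of_surjective (Φ : A →⋆ₐ[ℂ] B) (hΦ : Function.Surjective Φ) :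
    IsIsomorphicToQuotient B A := by
  refine ⟨RingHom.ker (Φ : A →ₐ[ℂ] B), inferInstance,
    Ideal.quotientKerAlgEquivOfSurjective (f := (Φ : A →ₐ[ℂ] B)) hΦ, ?_, fun a => ?_, fun a => ?_⟩
  · exact isClosed_eq Φ.continuous_of_cstar continuous_const
  · exact map_star Φ a
  · change ‖Φ a‖ = _
    have h0 : (0 : A) ∈ (RingHom.ker (Φ : A →ₐ[ℂ] B) : Set A) := Ideal.zero_mem _
    apply le_antisymm
    · refine (Metric.le_infDist ⟨0, h0⟩).2 fun x hx => ?_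
      have hx' : Φ x = 0 := hx
      rw [dist_eq_norm]
      calc ‖Φ a‖ = ‖Φ (a - x)‖ := by rw [map_sub, hx', sub_zero]
        _ ≤ ‖a - x‖ := NonUnitalStarAlgHom.norm_apply_le Φ _
    · obtain ⟨a', h1, h2⟩ := Φ.exists_lift_norm_le a
      have hm : a - a' ∈ (RingHom.ker (Φ : A →ₐ[ℂ] B) : Set A) := by
        change Φ (a - a') = 0
        rw [map_sub, h1, sub_self]
      refine (Metric.infDist_le_dist_of_mem hm).trans ?_
      rwa [dist_eq_norm, sub_sub_cancel]

end QuotientNorm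

/-! ### Normal form of words in two generators commuting up to a central factor. -/

section CommutingUpToCentral

variable {G : Type*} [Group G] {u v k : G}

lemma zpow_mul_zpow_of_mul_eq_central_mul (hk : ∀ x, Commute k x) (h : u * v = k * (v * u))
    (m n : ℤ) : u ^ m * v ^ n = k ^ (m * n) * (v ^ n * u ^ m) := by
  have h1 : SemiconjBy v u (k⁻¹ * u) := by
    rw [SemiconjBy, mul_assoc, h, inv_mul_cancel_left]
  have h2 : v * u ^ m = k⁻¹ ^ m * u ^ m * v := by
    rw [← ((hk u).inv_left).mul_zpow]; exact h1.zpow_right m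
  have h3 : SemiconjBy (u ^ m) v (k ^ m * v) := by
    rw [SemiconjBy, mul_assoc, h2, inv_zpow, mul_assoc, mul_inv_cancel_left]
  have h4 := h3.zpow_right n
  rw [((hk v).zpow_left m).mul_zpow, ← zpow_mul] at h4
  rw [h4.eq, mul_assoc]

/-- Moving `v^n` past `u^m'` costs only the central factor `k^(-m'n)`. Hence the monomials `u^m v^n`
span a dense subspace of `A_θ`. -/
lemma exists_freeGroup_lift_eq_zpow (hk : ∀ x, Commute k x) (h : u * v = k * (v * u))
    (g : FreeGroup (Fin 2)) :
    ∃ j m n : ℤ, FreeGroup.lift ![u, v] g = k ^ j * (u ^ m * v ^ n) := by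
  induction g using FreeGroup.induction_on with
  | C1 => exact ⟨0, 0, 0, by simp⟩
  | of i =>
    fin_cases i
    · exact ⟨0, 1, 0, by simp⟩
    · exact ⟨0, 0, 1, by simp⟩
  | inv_of i _ =>
    fin_cases i
    · exact ⟨0, -1, 0, by simp⟩
    · exact ⟨0, 0, -1, by simp⟩
  | mul x y hx hy =>
    obtain ⟨j, m, n, hx⟩ := hx
    obtain ⟨j', m', n', hy⟩ := hy
    refine ⟨j + j' - m' * n, m + m', n + n', ?_⟩
    have e : v ^ n * u ^ m' = k ^ (-(m' * n)) * (u ^ m' * v ^ n) := by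
      rw [zpow_mul_zpow_of_mul_eq_central_mul hk h, zpow_neg, inv_mul_cancel_left]
    have c : ∀ (i : ℤ) (x y : G), x * (k ^ i * y) = k ^ i * (x * y) := fun i x y => by
      rw [← mul_assoc, ← ((hk x).zpow_left i).eq, mul_assoc]
    calc FreeGroup.lift ![u, v] (x * y)
        = k ^ j * (u ^ m * v ^ n) * (k ^ j' * (u ^ m' * v ^ n')) := by rw [map_mul, hx, hy]
      _ = k ^ j * (k ^ j' * (u ^ m * (v ^ n * u ^ m') * v ^ n')) := by
        simp only [mul_assoc]
        rw [← mul_assoc (v ^ n) (k ^ j'), ← ((hk _).zpow_left j').eq]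
        simp only [mul_assoc]
        rw [c j' (u ^ m)]
      _ = k ^ (j + j' - m' * n) * (u ^ (m + m') * v ^ (n + n')) := by
        rw [e, c (-(m' * n)) (u ^ m), sub_eq_add_neg, zpow_add, zpow_add, zpow_add, zpow_add]
        simp only [mul_assoc]

end CommutingUpToCentral

/-! ### The gauge action and faithfulness of traces for irrational `θ`. -/

section ScalarUnitary

variable {D : Type*} [CStarAlgebra D]

/-- The scalar unitaries. -/
noncomputable def scalarUnitary : Circle →* unitary D where
  toFun z := ⟨(z : ℂ) • 1, by
    have h : (starRingEnd ℂ) z * (z : ℂ) = 1 := by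
      rw [← Complex.normSq_eq_conj_mul_self]; simp
    rw [Unitary.mem_iff]
    simp [smul_smul, h, mul_comm (z : ℂ)]⟩
  map_one' := Subtype.ext (by simp)
  map_mul' z w := Subtype.ext (by simp [smul_smul, mul_comm])

lemma coe_scalarUnitary_mul (z : Circle) (u : unitary D) :
    ((scalarUnitary z * u : unitary D) : D) = (z : ℂ) • (u : D) := by
  simp [scalarUnitary]

lemma commute_scalarUnitary (z : Circle) (u : unitary D) : Commute (scalarUnitary z) u :=
  Subtype.ext (by simp [scalarUnitary])

lemma continuous_scalarUnitary : Continuous (scalarUnitary : Circle → unitary D) :=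
  Continuous.subtype_mk (by fun_prop) _

end ScalarUnitary

/-- The number `e^{2πiθ}` as a point of the circle. -/
noncomputable def rotationNumber (θ : ℝ) : Circle := Circle.exp (2 * Real.pi * θ)

lemma coe_rotationNumber (θ : ℝ) :
    (rotationNumber θ : ℂ) = Complex.exp (2 * Real.pi * Complex.I * θ) := by
  rw [rotationNumber, Circle.coe_exp]
  congr 1
  push_cast
  ring

lemma rotationNumber_zpow_ne_one {θ : ℝ} (hθ : Irrational θ) {n : ℤ} (hn : n ≠ 0) :
    rotationNumber θ ^ n ≠ 1 := by
  rw [rotationNumber, ← Circle.exp_zsmul, Ne, Circle.exp_eq_one]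
  rintro ⟨k, hk⟩
  have h2 : (n : ℝ) * θ = k := by
    have : (2 * Real.pi) * ((n : ℝ) * θ) = (2 * Real.pi) * k := by
      rw [zsmul_eq_mul] at hk; linarith
    exact mul_left_cancel₀ (by positivity) this
  exact (hθ.intCast_mul hn).ne_int k h2

namespace RotationAlgebra

variable {θ : ℝ}

/-- The canonical homomorphism from the free group to the unitary group of `A_θ`. -/
noncomputable def wordUnitary : FreeGroup (Fin 2) →* unitary (RotationAlgebra θ) where
  toFun g := ⟨of (PreRotation.single g 1), by
    rw [Unitary.mem_iff, star_of, PreRotation.star_single, ← of_mul, ← of_mul,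
      PreRotation.single_mul, PreRotation.single_mul, ← of_one, PreRotation.one_eq]
    simp⟩
  map_one' := rfl
  map_mul' g h := Subtype.ext (by
    change of _ = of _ * of _
    rw [← of_mul, PreRotation.single_mul, one_mul])

/-- The first canonical generator. -/
noncomputable def genU : unitary (RotationAlgebra θ) := wordUnitary (FreeGroup.of 0)

/-- The second canonical generator. -/
noncomputable def genV : unitary (RotationAlgebra θ) := wordUnitary (FreeGroup.of 1)

lemma of_single (g : FreeGroup (Fin 2)) (c : ℂ) :
    (of (PreRotation.single g c) : RotationAlgebra θ) = c • (wordHom genU genV g : unitary (RotationAlgebra θ)).1 := by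
  have h : wordHom genU genV = (wordUnitary : _ →* unitary (RotationAlgebra θ)) := by
    refine FreeGroup.ext_hom _ _ fun i => ?_
    fin_cases i
    · exact wordHom_of_zero _ _
    · exact wordHom_of_one _ _
  rw [h]
  change _ = c • of _
  rw [← of_smul, PreRotation.smul_single, mul_one]

lemma genU_mul_genV :
    (genU * genV : unitary (RotationAlgebra θ)) =
      scalarUnitary (rotationNumber θ) * (genV * genU) := by
  apply Subtype.ext
  rw [coe_scalarUnitary_mul, coe_rotationNumber]
  change of PreRotation.U * of PreRotation.V = _ • (of PreRotation.V * of PreRotation.U)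
  rw [← of_mul, ← of_mul, ← of_smul, ← sub_eq_zero, ← norm_eq_zero]
  have e : of (PreRotation.U * PreRotation.V) -
      of (Complex.exp (2 * Real.pi * Complex.I * θ) • (PreRotation.V * PreRotation.U)) =
      (of (PreRotation.U * PreRotation.V - Complex.exp (2 * Real.pi * Complex.I * θ) •
        (PreRotation.V * PreRotation.U)) : RotationAlgebra θ) :=
    (UniformSpace.Completion.coe_sub _ _).symm
  rw [e, norm_of]
  exact le_antisymm (PreRotation.universalNorm_le fun p => p.2.relation.le) (norm_nonneg _)

/-- The gauge action of the torus on `A_θ`. -/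
noncomputable def gauge (z w : Circle) : RotationAlgebra θ →⋆ₐ[ℂ] RotationAlgebra θ :=
  lift (scalarUnitary z * genU) (scalarUnitary w * genV) <| by
    have h := congrArg (Subtype.val) (genU_mul_genV (θ := θ))
    rw [coe_scalarUnitary_mul, coe_rotationNumber] at h
    rw [coe_scalarUnitary_mul, coe_scalarUnitary_mul, smul_mul_smul_comm, smul_mul_smul_comm,
      smul_comm, ← Submonoid.coe_mul, ← Submonoid.coe_mul, h, mul_comm (z : ℂ)]

lemma gauge_of_single (z w : Circle) (g : FreeGroup (Fin 2)) (c : ℂ) :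
    gauge z w (of (PreRotation.single g c) : RotationAlgebra θ) =
      c • (wordHom (scalarUnitary z * genU) (scalarUnitary w * genV) g : unitary (RotationAlgebra θ)).1 := by
  rw [gauge, lift_of, PreRotation.lift_single]

lemma gauge_one_one (a : RotationAlgebra θ) : gauge 1 1 a = a := by
  induction a using induction with
  | hc => exact isClosed_eq (StarAlgHom.continuous_of_cstar _) continuous_id
  | h a =>
    induction a using PreRotation.induction with
    | h0 =>
      have : of (0 : PreRotation θ) = 0 := UniformSpace.Completion.coe_zero
      rw [this, map_zero]
    | hs g c => rw [gauge_of_single, of_single]; simp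
    | hadd a b ha hb => rw [of_add, map_add, ha, hb]

lemma gauge_monomial (z w : Circle) (m n : ℤ) :
    gauge z w ((genU ^ m * genV ^ n : unitary (RotationAlgebra θ)) : RotationAlgebra θ) =
      ((z ^ m * w ^ n : Circle) : ℂ) • ((genU ^ m * genV ^ n : unitary (RotationAlgebra θ)) : _) := by
  have e : (genU ^ m * genV ^ n : unitary (RotationAlgebra θ)) =
      wordUnitary (FreeGroup.of 0 ^ m * FreeGroup.of 1 ^ n) := by
    rw [map_mul, map_zpow, map_zpow]; rfl
  have e2 : gauge z w ((genU ^ m * genV ^ n : unitary (RotationAlgebra θ)) : RotationAlgebra θ) =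
      (wordHom (scalarUnitary z * genU) (scalarUnitary w * genV)
        (FreeGroup.of 0 ^ m * FreeGroup.of 1 ^ n) : unitary (RotationAlgebra θ)).1 := by
    rw [e]
    exact (gauge_of_single z w _ 1).trans (one_smul _ _)
  rw [e2, map_mul, map_zpow, map_zpow, wordHom_of_zero, wordHom_of_one,
    (commute_scalarUnitary z _).mul_zpow, (commute_scalarUnitary w _).mul_zpow,
    ← coe_scalarUnitary_mul, map_mul, map_zpow, map_zpow]
  congr 1
  rw [mul_assoc, mul_assoc, ← mul_assoc (genU ^ m), ← map_zpow, ← map_zpow,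
    ← (commute_scalarUnitary _ (genU ^ m)).eq, mul_assoc]

/-- Continuity is clear on words. Each `gauge z w` is contractive, so approximation of `a` by word
combinations is uniform over the torus. -/
lemma continuous_gauge (a : RotationAlgebra θ) :
    Continuous fun p : Circle × Circle => gauge p.1 p.2 a := by
  have hword : ∀ g : FreeGroup (Fin 2), Continuous fun p : Circle × Circle =>
      wordHom (scalarUnitary p.1 * genU) (scalarUnitary p.2 * genV : unitary (RotationAlgebra θ)) g := by
    have h1 : Continuous fun p : Circle × Circle =>
        (scalarUnitary p.1 * genU : unitary (RotationAlgebra θ)) :=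
      (continuous_scalarUnitary.comp continuous_fst).mul continuous_const
    have h2 : Continuous fun p : Circle × Circle =>
        (scalarUnitary p.2 * genV : unitary (RotationAlgebra θ)) :=
      (continuous_scalarUnitary.comp continuous_snd).mul continuous_const
    intro g
    induction g using FreeGroup.induction_on with
    | C1 => simpa using continuous_const
    | of i =>
      fin_cases i
      · simpa using h1
      · simpa using h2
    | inv_of i h => simp only [map_inv]; exact h.inv
    | mul x y hx hy => simp only [map_mul]; exact hx.mul hy
  have hof : ∀ b : PreRotation θ, Continuous fun p : Circle × Circle => gauge p.1 p.2 (of b) := by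
    intro b
    induction b using PreRotation.induction with
    | h0 =>
      have : of (0 : PreRotation θ) = 0 := UniformSpace.Completion.coe_zero
      simpa only [this, map_zero] using continuous_const
    | hs g c =>
      simp only [gauge_of_single]
      exact (continuous_subtype_val.comp (hword g)).const_smul c
    | hadd a b ha hb => simp only [of_add, map_add]; exact ha.add hb
  refine continuous_of_uniform_approx_of_continuous fun s hs => ?_
  obtain ⟨ε, hε, hs⟩ := Metric.mem_uniformity_dist.1 hs
  obtain ⟨b, hb⟩ := denseRange_of.exists_dist_lt a hε
  refine ⟨_, hof b, fun p => hs ?_⟩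
  rw [dist_eq_norm, ← map_sub]
  exact (NonUnitalStarAlgHom.norm_apply_le (gauge p.1 p.2) _).trans_lt (by rwa [← dist_eq_norm])

lemma eq_of_eq_on_monomials {f g : RotationAlgebra θ →ₗ[ℂ] ℂ} (hf : Continuous f)
    (hg : Continuous g)
    (h : ∀ m n : ℤ, f ((genU ^ m * genV ^ n : unitary (RotationAlgebra θ)) : _) =
      g ((genU ^ m * genV ^ n : unitary (RotationAlgebra θ)) : _)) : f = g := by
  ext a
  induction a using induction with
  | hc => exact isClosed_eq hf hg
  | h a =>
    induction a using PreRotation.induction with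
    | h0 =>
      have : of (0 : PreRotation θ) = 0 := UniformSpace.Completion.coe_zero
      rw [this, map_zero, map_zero]
    | hs w c =>
      obtain ⟨j, m, n, hw⟩ := exists_freeGroup_lift_eq_zpow
        (commute_scalarUnitary (rotationNumber θ)) genU_mul_genV w
      rw [of_single, wordHom, hw, ← map_zpow, coe_scalarUnitary_mul]
      simp only [map_smul, h]
    | hadd a b ha hb => rw [of_add, map_add, map_add, ha, hb]

/-- Conjugation by `genU` multiplies the monomial by `e^{2πinθ}`, and for `n = 0` conjugation by
`genV` multiplies it by `e^{-2πimθ}`. A trace ignores conjugation, and for irrational `θ` one of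
these factors is not `1`. -/
lemma tracial_apply_monomial_eq_zero (hθ : Irrational θ) (f : RotationAlgebra θ →ₗ[ℂ] ℂ)
    (hf : ∀ a b, f (a * b) = f (b * a)) {m n : ℤ} (hmn : ¬(m = 0 ∧ n = 0)) :
    f ((genU ^ m * genV ^ n : unitary (RotationAlgebra θ)) : RotationAlgebra θ) = 0 := by
  have hconj : ∀ x y : unitary (RotationAlgebra θ),
      f ((x * y * x⁻¹ : unitary (RotationAlgebra θ)) : RotationAlgebra θ) = f y := fun x y => by
    rw [Submonoid.coe_mul, hf, ← Submonoid.coe_mul, ← mul_assoc, inv_mul_cancel, one_mul]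
  have hzero : ∀ (x y : unitary (RotationAlgebra θ)) (i : ℤ), i ≠ 0 →
      x * y * x⁻¹ = scalarUnitary (rotationNumber θ ^ i) * y → f (y : RotationAlgebra θ) = 0 := by
    intro x y i hi h
    have h1 := hconj x y
    rw [h, coe_scalarUnitary_mul, map_smul, smul_eq_mul] at h1
    by_contra h0
    exact rotationNumber_zpow_ne_one hθ hi (Subtype.ext ((mul_eq_right₀ h0).1 h1))
  have hc := commute_scalarUnitary (D := RotationAlgebra θ) (rotationNumber θ)
  have hz := zpow_mul_zpow_of_mul_eq_central_mul hc genU_mul_genV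
  by_cases hn : n = 0
  · subst hn
    have hm : m ≠ 0 := fun h => hmn ⟨h, rfl⟩
    refine hzero genV _ (-m) (neg_ne_zero.2 hm) ?_
    have h1 := hz m 1
    rw [zpow_one, mul_one] at h1
    rw [zpow_zero, mul_one, map_zpow, mul_inv_eq_iff_eq_mul, mul_assoc, h1, zpow_neg,
      inv_mul_cancel_left]
  · refine hzero genU _ n hn ?_
    have h1 := hz 1 n
    rw [zpow_one, one_mul] at h1
    rw [map_zpow, mul_inv_eq_iff_eq_mul, ← mul_assoc, ← zpow_one_add, add_comm, zpow_add_one,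
      mul_assoc, h1, ← mul_assoc, ← ((hc _).zpow_left n).eq]
    simp only [mul_assoc]

open MeasureTheory in
/-- The mean of a state over the gauge action. -/
lemma exists_gauge_mean (φ : RotationAlgebra θ →ₗ[ℂ] ℂ) (hφ : ∀ x, ‖φ x‖ ≤ ‖x‖) (hφ1 : φ 1 = 1) :
    ∃ ψ : RotationAlgebra θ →ₗ[ℂ] ℂ, Continuous ψ ∧ ψ 1 = 1 ∧
      (∀ (m n : ℤ) (s t : UnitAddCircle),
        AddCircle.toCircle s ^ m * AddCircle.toCircle t ^ n ≠ 1 →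
        ψ ((genU ^ m * genV ^ n : unitary (RotationAlgebra θ)) : RotationAlgebra θ) = 0) ∧
      ∀ a, φ (star a * a) ≠ 0 → ψ (star a * a) ≠ 0 := by
  have hφc : Continuous φ := (φ.mkContinuous 1 (by simpa using hφ)).continuous
  obtain ⟨μ, hμ, hμ1⟩ : ∃ μ : Measure (UnitAddCircle × UnitAddCircle),
      μ.IsAddHaarMeasure ∧ IsProbabilityMeasure μ :=
    ⟨AddCircle.haarAddCircle.prod AddCircle.haarAddCircle, inferInstance, inferInstance⟩
  obtain ⟨F, hFdef⟩ : ∃ F : RotationAlgebra θ → UnitAddCircle × UnitAddCircle → ℂ, ∀ x p, F x p =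
      φ (gauge (AddCircle.toCircle p.1) (AddCircle.toCircle p.2) x) := ⟨_, fun _ _ => rfl⟩
  have hF : ∀ x, Continuous (F x) := fun x => by
    have h1 : Continuous fun p : UnitAddCircle × UnitAddCircle =>
        (AddCircle.toCircle p.1, AddCircle.toCircle p.2) :=
      (AddCircle.continuous_toCircle.comp continuous_fst).prodMk
        (AddCircle.continuous_toCircle.comp continuous_snd)
    have h2 := hφc.comp ((continuous_gauge x).comp h1)
    rw [funext (hFdef x)]
    exact h2
  have hFi : ∀ x, Integrable (F x) μ := fun x =>
    (hF x).integrable_of_hasCompactSupport (HasCompactSupport.of_compactSpace _)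
  have hFn : ∀ x p, ‖F x p‖ ≤ ‖x‖ := fun x p => by
    rw [hFdef]
    exact (hφ _).trans (NonUnitalStarAlgHom.norm_apply_le _ _)
  refine ⟨{
      toFun := fun x => ∫ p, F x p ∂μ
      map_add' := fun x y => by
        rw [← integral_add (hFi x) (hFi y)]
        simp only [hFdef, map_add]
      map_smul' := fun c x => by
        rw [RingHom.id_apply, ← integral_smul]
        simp only [hFdef, map_smul] }, ?_, ?_, ?_, ?_⟩
  · exact (LinearMap.mkContinuous _ 1 fun x => by
      rw [one_mul]
      simpa using norm_integral_le_of_norm_le_const (μ := μ) (.of_forall (hFn x))).continuous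
  · change ∫ p, F 1 p ∂μ = 1
    simp [hFdef, hφ1]
  · intro m n s t hp
    change ∫ p, F _ p ∂μ = 0
    have h1 : ∀ p, F ((genU ^ m * genV ^ n : unitary (RotationAlgebra θ)) : _) (p + (s, t)) =
        ((AddCircle.toCircle s ^ m * AddCircle.toCircle t ^ n : Circle) : ℂ) *
          F ((genU ^ m * genV ^ n : unitary (RotationAlgebra θ)) : _) p := by
      intro p
      rw [hFdef, hFdef, gauge_monomial, gauge_monomial, map_smul, map_smul, smul_eq_mul,
        smul_eq_mul, Prod.fst_add, Prod.snd_add, AddCircle.toCircle_add, AddCircle.toCircle_add,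
        mul_zpow, mul_zpow]
      simp only [Circle.coe_mul]
      ring
    -- Translating by `(s, t)` preserves the integral but multiplies it by a number other than `1`.
    have h2 := integral_add_right_eq_self (μ := μ)
      (F ((genU ^ m * genV ^ n : unitary (RotationAlgebra θ)) : _)) (s, t)
    simp only [h1] at h2
    rw [integral_const_mul] at h2
    by_contra h3
    exact hp (Subtype.ext ((mul_eq_right₀ h3).1 h2))
  · intro a hφa
    change ∫ p, F _ p ∂μ ≠ 0
    have hnonneg : ∀ p, 0 ≤ F (star a * a) p := fun p => by
      rw [hFdef, map_mul, map_star]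
      exact apply_star_mul_self_nonneg φ hφ hφ1 _
    have hF0 : F (star a * a) 0 = φ (star a * a) := by
      rw [hFdef, Prod.fst_zero, Prod.snd_zero, AddCircle.toCircle_zero, gauge_one_one]
    have hre0 : (F (star a * a) 0).re ≠ 0 := fun h =>
      hφa (hF0 ▸ Complex.ext h (Complex.le_def.1 (hnonneg 0)).2.symm)
    -- The integrand is continuous, nonnegative and nonzero at the identity of the torus.
    have hpos : 0 < ∫ p, (F (star a * a) p).re ∂μ :=
      Continuous.integral_pos_of_hasCompactSupport_nonneg_nonzero
        (Complex.continuous_re.comp (hF _)) (HasCompactSupport.of_compactSpace _)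
        (fun p => (Complex.le_def.1 (hnonneg p)).1) hre0
    have hint : ∫ p, (F (star a * a) p).re ∂μ = (∫ p, F (star a * a) p ∂μ).re :=
      integral_re (𝕜 := ℂ) (hFi _)
    intro h
    rw [hint, h] at hpos
    exact lt_irrefl _ hpos

/-- For irrational `θ`, every continuous tracial functional `f` on `A_θ` with `f 1 = 1` is faithful:
it is the mean of any state over the gauge action. -/
lemma eq_zero_of_tracial_apply_star_mul_self_eq_zero (hθ : Irrational θ)
    (f : RotationAlgebra θ →ₗ[ℂ] ℂ) (hfc : Continuous f) (hf : ∀ a b, f (a * b) = f (b * a))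
    (hf1 : f 1 = 1) {a : RotationAlgebra θ} (ha : f (star a * a) = 0) : a = 0 := by
  by_contra h0
  have hsa : IsStarNormal (star a * a) := (IsSelfAdjoint.star_mul_self a).isStarNormal
  have hne : star a * a ≠ 0 := fun h => h0 ((CStarRing.star_mul_self_eq_zero_iff a).1 h)
  obtain ⟨φ, hφ, hφ1, hφa⟩ := exists_state_apply_ne_zero hne
  obtain ⟨ψ, hψc, hψ1, hinv, hψa⟩ := exists_gauge_mean φ hφ hφ1
  have htc : AddCircle.toCircle ((θ : ℝ) : UnitAddCircle) = rotationNumber θ := by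
    rw [AddCircle.toCircle_apply_mk, div_one, rotationNumber]
  have hψ : ψ = f := by
    refine eq_of_eq_on_monomials hψc hfc fun m n => ?_
    by_cases hmn : m = 0 ∧ n = 0
    · obtain ⟨rfl, rfl⟩ := hmn
      simp only [zpow_zero, mul_one, OneMemClass.coe_one, hf1, hψ1]
    · rw [tracial_apply_monomial_eq_zero hθ f hf hmn]
      by_cases hm : m = 0
      · have hn : n ≠ 0 := fun h => hmn ⟨hm, h⟩
        -- At the torus point `(0, θ)` the character of the monomial is `e^{2πinθ}`.
        refine hinv m n 0 ((θ : ℝ) : UnitAddCircle) ?_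
        rw [htc, AddCircle.toCircle_zero, one_zpow, one_mul]
        exact rotationNumber_zpow_ne_one hθ hn
      · refine hinv m n ((θ : ℝ) : UnitAddCircle) 0 ?_
        rw [htc, AddCircle.toCircle_zero, one_zpow, mul_one]
        exact rotationNumber_zpow_ne_one hθ hm
  exact hψa a hφa (hψ ▸ ha)

end RotationAlgebra

/-! ### The main theorem. -/

theorem theorem3p7 {A : Type*} [CStarAlgebra A] (u v : A)
    (hu : u ∈ unitary A) (hv : v ∈ unitary A)
    (hδ : ‖u * v - v * u‖ < 2)
    (hcu : Commute (u * v * star u * star v) u)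
    (hcv : Commute (u * v * star u * star v) v)
    (θ : ℝ) (hθ : θ ∈ Set.Ioo (-(1 / 2) : ℝ) (1 / 2))
    (hT : Nonempty (TracialState (cstarGenerated u v)))
    (hτ : ∀ τ : TracialState (cstarGenerated u v),
      1 / (2 * Real.pi * Complex.I) *
        τ.toLinearMap (cstarLog (cstarGenerated.commutator u v)) = (θ : ℂ)) :
    IsIsomorphicToQuotient (cstarGenerated u v) (RotationAlgebra θ) ∧
      u * v = Complex.exp (2 * Real.pi * Complex.I * θ) • (v * u) ∧
      (Irrational θ → Nonempty (cstarGenerated u v ≃⋆ₐ[ℂ] RotationAlgebra θ)) := by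
  set B := cstarGenerated u v
  let x : B := cstarGenerated.fst u v
  let y : B := cstarGenerated.snd u v
  have hgen : (StarAlgebra.adjoin ℂ {x, y}).topologicalClosure = ⊤ :=
    cstarGenerated.topologicalClosure_adjoin u v
  have hx : x ∈ unitary B :=
    Unitary.mem_iff.2 ⟨Subtype.ext (Unitary.mem_iff.1 hu).1, Subtype.ext (Unitary.mem_iff.1 hu).2⟩
  have hy : y ∈ unitary B :=
    Unitary.mem_iff.2 ⟨Subtype.ext (Unitary.mem_iff.1 hv).1, Subtype.ext (Unitary.mem_iff.1 hv).2⟩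
  have hcx : Commute (x * y * star x * star y) x := Subtype.ext hcu
  have hcy : Commute (x * y * star x * star y) y := Subtype.ext hcv
  have hw : x * y * star x * star y = Complex.exp (2 * Real.pi * Complex.I * θ) • (1 : B) := by
    refine commutator_eq_exp_smul_one hgen hx hy hδ hcx hcy _ fun τ => ?_
    have h2 : (2 * Real.pi * Complex.I : ℂ) ≠ 0 := Complex.two_pi_I_ne_zero
    rw [← hτ τ, ← mul_assoc, mul_one_div_cancel h2, one_mul]
    rfl
  have hrel : x * y = Complex.exp (2 * Real.pi * Complex.I * θ) • (y * x) := by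
    rw [mul_eq_commutator_mul hx hy, hw, smul_mul_assoc, one_mul]
  let Φ : RotationAlgebra θ →⋆ₐ[ℂ] B := RotationAlgebra.lift ⟨x, hx⟩ ⟨y, hy⟩ hrel
  have hsurj : Function.Surjective Φ := by
    refine Φ.surjective_of_denseRange fun b => ?_
    have hb : b ∈ (StarAlgebra.adjoin ℂ {x, y}).topologicalClosure := hgen ▸ trivial
    refine closure_mono (?_ : (StarAlgebra.adjoin ℂ {x, y} : Set B) ⊆ Set.range Φ) hb
    have hle : StarAlgebra.adjoin ℂ {x, y} ≤ Φ.range := by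
      refine StarAlgebra.adjoin_le ?_
      rintro _ (rfl | rfl)
      · exact ⟨RotationAlgebra.of PreRotation.U,
          (RotationAlgebra.lift_of _ _ hrel _).trans (PreRotation.lift_U _ _)⟩
      · exact ⟨RotationAlgebra.of PreRotation.V,
          (RotationAlgebra.lift_of _ _ hrel _).trans (PreRotation.lift_V _ _)⟩
    exact hle
  refine ⟨isIsomorphicToQuotient_of_surjective Φ hsurj, congrArg Subtype.val hrel, fun hirr => ?_⟩
  -- The given trace serves to make `B` nonzero. The trace used below is built afresh, since the
  -- construction supplies the contractivity from which its continuity follows.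
  have hB : (1 : B) ≠ 0 := fun h => by
    obtain ⟨τ⟩ := hT
    have := τ.map_one
    rw [h, map_zero] at this
    exact zero_ne_one this
  obtain ⟨φ, hφ, hφ1, -⟩ := exists_state_apply_ne_zero hB
  obtain ⟨τ, hτn, -⟩ := exists_tracialState_eq_on_center hgen hx hy hcx hcy φ hφ hφ1
  have hτc : Continuous τ.toLinearMap :=
    (τ.toLinearMap.mkContinuous 1 (by simpa using hτn)).continuous
  have hinj : Function.Injective Φ := by
    rw [injective_iff_map_eq_zero]
    intro a ha
    -- The pulled-back trace is faithful on `A_θ` and vanishes at `a⋆a` for `a` in the kernel.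
    refine RotationAlgebra.eq_zero_of_tracial_apply_star_mul_self_eq_zero hirr
      (τ.toLinearMap ∘ₗ Φ.toAlgHom.toLinearMap) (hτc.comp Φ.continuous_of_cstar)
      (fun a b => ?_) ?_ ?_
    · change τ.toLinearMap (Φ (a * b)) = τ.toLinearMap (Φ (b * a))
      rw [map_mul Φ, map_mul Φ, τ.trace]
    · change τ.toLinearMap (Φ 1) = 1
      rw [map_one Φ, τ.map_one]
    · change τ.toLinearMap (Φ (star a * a)) = 0
      rw [map_mul Φ, ha, mul_zero, map_zero]
  exact ⟨(StarAlgEquiv.ofBijective Φ ⟨hinj, hsurj⟩).symm⟩
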